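/- Let $m \ge n \ge 3$ be integers. The $m \times n$ projective checkerboard is the digraph whose vertices (squares) are the pairs $(p,q)$ of integers with $0 \le p \le m-1$ and $0 \le q \le n-1$, with a directed edge from each square $\sigma$ to $\sigma E$ and to $\sigma N$, where $(p,q)E = (p+1,q)$ if $p < m-1$ and $(m-1,q)E = (0,n-1-q)$, and $(p,q)N = (p,q+1)$ if $q < n-1$ and $(p,n-1)N = (m-1-p,0)$. A hamiltonian path is a directed path that visits every square exactly once. Let $\iota = (0,q)$ with $1 \le q \le n-1$, and let $(x,y)$ be a square. There is a hamiltonian path from $\iota$ to $(x,y)$ in the $m \times n$ projective checkerboard if and only if either (a) $x+y = q-1 \ge \lfloor (n-1)/2 \rfloor$ and $\lfloor (n-1)/2 \rfloor \le x \le \lfloor (m-1)/2 \rfloor$, or (b) $x+y = m+n-q-2$ and $\lfloor m/2 \rfloor \le x \le m - \lceil n/2 \rceil$ (and $q \ge \lfloor (n-1)/2 \rfloor$). -/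

import Mathlib

/-- One step to the east on the `m × n` board:
`(p, q)E = (p + 1, q)` if `p < m - 1`, and `(0, n - 1 - q)` if `p = m - 1`. -/
def stepEast {m n : ℕ} (s : Fin m × Fin n) : Fin m × Fin n :=
  if h : s.1.val + 1 < m then (⟨s.1.val + 1, h⟩, s.2)
  else (⟨0, s.1.pos⟩, ⟨n - 1 - s.2.val, by omega⟩)

/-- One step to the north on the `m × n` board:
`(p, q)N = (p, q + 1)` if `q < n - 1`, and `(m - 1 - p, 0)` if `q = n - 1`. -/
def stepNorth {m n : ℕ} (s : Fin m × Fin n) : Fin m × Fin n :=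
  if h : s.2.val + 1 < n then (s.1, ⟨s.2.val + 1, h⟩)
  else (⟨m - 1 - s.1.val, by omega⟩, ⟨0, s.2.pos⟩)

/-- The `m × n` projective checkerboard: the digraph on the squares `(p, q)`, `0 ≤ p ≤ m - 1`,
`0 ≤ q ≤ n - 1`, with a directed edge from each square `s` to `sE` and to `sN`. -/
def projectiveCheckerboard (m n : ℕ) : Digraph (Fin m × Fin n) where
  Adj s t := t = stepEast s ∨ t = stepNorth s

/-- `l` is the list of successive vertices of a hamiltonian path of the digraph `G` from `u`
to `v`: consecutive vertices are joined by directed edges, every vertex occurs exactly once,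
the first vertex is `u` and the last one is `v`. -/
structure IsHamiltonianPath {V : Type*} (G : Digraph V) (u v : V) (l : List V) : Prop where
  chain : l.IsChain G.Adj
  nodup : l.Nodup
  mem : ∀ w : V, w ∈ l
  head : l.head? = some u
  last : l.getLast? = some v

/-! Sending the last square back to the first closes a hamiltonian path up to a cyclic permutation
`f`. Call `p + q` the level of `(p, q)`, and let diagonal `i` consist of the levels `i` and `m + n -
3 - i`. Distinct squares `σ`, `σ'` with `σE = σ'N` lie on one diagonal, and `σ` cannot go east while
`σ'` goes north. Running along a diagonal, this makes every diagonal without the terminal square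
uniform (`ClosedTour.travels`). If the path starts at `(0, a + 1)`, both board predecessors of that
square lie on diagonal `a`; this puts the terminal square there and fixes all directions on it
(`ClosedTour.firstEntry`).

Whether `f` is a single cycle is read off its first return map to the level `c = m + n - 3 - a`.
Above `c`, the corner acts as the antipodal map whatever the directions are (`flows_outer`), so the
terminal square enters only through one number `z` (`FirstEntry`). Below `c`, working outwards from
the middle, the passage from a level to its antipode reverses the first `K` rows: an east diagonal
keeps `K`, a north one lowers it by 2. Choices that close a cycle missing level `c` are excluded,
and column reversals arise only as a degenerate case (`ClosedTour.exists_reversal`).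

A single cycle needs `z = K / 2` (`FirstEntry.eq_half`), or `z = 0` in the column case. The possible
range of `K` gives `2z + n ≤ 2a + 4` and `2a + 3 ≤ m + 2z`, which amount to (a) and (b). Conversely,
within these bounds a suitable number of north diagonals makes `K / 2 = z`, and `tour` is then one
cycle. -/

/-! ### Hamiltonian paths as cyclic permutations. -/

theorem IsHamiltonianPath.exists_perm {V : Type*} [DecidableEq V] {G : Digraph V} {u v : V}
    {l : List V} (h : IsHamiltonianPath G u v l) :
    ∃ f : Equiv.Perm V, f v = u ∧ (∀ w, w ≠ v → G.Adj w (f w)) ∧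
      ∀ s t, ∃ k : ℕ, f^[k] s = t := by
  obtain ⟨hc, hd, hm, hh, hl⟩ := h
  have hpos : 0 < l.length := List.length_pos_of_mem (hm u)
  have hu : l[0] = u := by
    rw [List.head?_eq_getElem?, List.getElem?_eq_getElem hpos] at hh
    exact Option.some.inj hh
  have hv : l[l.length - 1] = v := by
    rw [List.getLast?_eq_getElem?, List.getElem?_eq_getElem (by omega)] at hl
    exact Option.some.inj hl
  refine ⟨l.formPerm, ?_, ?_, ?_⟩
  · rw [← hv, List.formPerm_apply_getElem _ hd, ← hu]
    congr 1
    rw [Nat.sub_add_cancel hpos, Nat.mod_self]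
  · intro w hw
    obtain ⟨i, hi, rfl⟩ := List.getElem_of_mem (hm w)
    have hi' : i + 1 < l.length := by
      by_contra hcon
      apply hw
      rw [← hv]
      congr 1
      omega
    rw [List.formPerm_apply_getElem _ hd]
    have := (List.isChain_iff_getElem.1 hc) i hi'
    simpa only [Nat.mod_eq_of_lt hi'] using this
  · intro s t
    obtain ⟨i, hi, rfl⟩ := List.getElem_of_mem (hm s)
    obtain ⟨j, hj, rfl⟩ := List.getElem_of_mem (hm t)
    -- Adding the period `l.length` keeps the exponent valid when `j < i`.
    refine ⟨j + l.length - i, ?_⟩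
    rw [← Equiv.Perm.coe_pow, List.formPerm_pow_apply_getElem _ hd]
    congr 1
    rw [show i + (j + l.length - i) = j + l.length by omega, Nat.add_mod_right,
      Nat.mod_eq_of_lt hj]

/-- The path is the orbit of `u` up to its first visit to `v`; as `f v = u`, the orbit only repeats
itself from there on. -/
theorem exists_isHamiltonianPath {V : Type*} {G : Digraph V} {u v : V} (f : V → V)
    (hf : f v = u) (hadj : ∀ w, w ≠ v → G.Adj w (f w)) (hreach : ∀ t, ∃ k : ℕ, f^[k] u = t) :
    ∃ l, IsHamiltonianPath G u v l := by
  classical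
  obtain ⟨k, hk, hmin⟩ : ∃ k, f^[k] u = v ∧ ∀ j < k, f^[j] u ≠ v :=
    ⟨Nat.find (hreach v), Nat.find_spec (hreach v), fun j hj => Nat.find_min (hreach v) hj⟩
  have hper : f^[k + 1] u = u := by rw [Function.iterate_succ_apply', hk, hf]
  refine ⟨(List.range (k + 1)).map (fun j => f^[j] u), ?_, ?_, ?_, ?_, ?_⟩
  · rw [List.isChain_iff_getElem]
    intro i hi
    simp only [List.length_map, List.length_range] at hi
    simp only [List.getElem_map, List.getElem_range]
    rw [Function.iterate_succ_apply']
    exact hadj _ (hmin i (by omega))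
  · refine List.Nodup.map_on ?_ List.nodup_range
    have key : ∀ i j, i < j → j ≤ k → f^[i] u ≠ f^[j] u := by
      intro i j hij hj h
      have h2 : f^[k - j] (f^[i] u) = f^[k - j] (f^[j] u) := by rw [h]
      rw [← Function.iterate_add_apply, ← Function.iterate_add_apply,
        Nat.sub_add_cancel hj, hk] at h2
      exact hmin _ (by omega) h2
    intro i hi j hj h
    rw [List.mem_range] at hi hj
    rcases lt_trichotomy i j with hlt | rfl | hlt
    · exact absurd h (key i j hlt (by omega))
    · rfl
    · exact absurd h.symm (key j i hlt (by omega))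
  · intro w
    obtain ⟨j, rfl⟩ := hreach w
    rw [List.mem_map]
    refine ⟨j % (k + 1), List.mem_range.2 (Nat.mod_lt _ (by omega)), ?_⟩
    exact Function.IsPeriodicPt.iterate_mod_apply hper j
  · simp
  · rw [List.getLast?_eq_getElem?, List.length_map, List.length_range, Nat.add_sub_cancel,
      List.getElem?_map, List.getElem?_range (Nat.lt_succ_self k)]
    exact congrArg some hk

/-- Injectivity on a finite set makes `t` periodic, so the orbit of `t`, having passed through `v`,
comes back to `t`. -/
theorem reaches_of_injective {V : Type*} [Finite V] {f : V → V} (hf : Function.Injective f)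
    {v : V} (h : ∀ w, ∃ k : ℕ, f^[k] w = v) (s t : V) : ∃ k : ℕ, f^[k] s = t := by
  obtain ⟨i, hi⟩ := h s
  obtain ⟨j, hj⟩ := h t
  obtain ⟨N, hN, hp⟩ := hf.mem_periodicPts t
  have hp' : f^[N * j] t = t := by
    rw [mul_comm]; exact hp.const_mul j
  refine ⟨(N * j - j) + i, ?_⟩
  rw [Function.iterate_add_apply, hi, ← hj, ← Function.iterate_add_apply,
    Nat.sub_add_cancel (Nat.le_mul_of_pos_left _ hN), hp']

/-! ### Translation to natural-number coordinates. -/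

/-- `stepEast` in natural-number coordinates. -/
def eastward (m n : ℕ) (s : ℕ × ℕ) : ℕ × ℕ :=
  if s.1 + 1 < m then (s.1 + 1, s.2) else (0, n - 1 - s.2)

/-- `stepNorth` in natural-number coordinates. -/
def northward (m n : ℕ) (s : ℕ × ℕ) : ℕ × ℕ :=
  if s.2 + 1 < n then (s.1, s.2 + 1) else (m - 1 - s.1, 0)

/-- A hamiltonian path from `(0, b)` to `(x, y)`, closed up to a cyclic permutation `f` of the
board by sending `(x, y)` back to `(0, b)`. -/
structure ClosedTour (m n b x y : ℕ) (f : ℕ × ℕ → ℕ × ℕ) : Prop where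
  step : ∀ p q, p < m → q < n → (p, q) ≠ (x, y) →
    f (p, q) = eastward m n (p, q) ∨ f (p, q) = northward m n (p, q)
  close : f (x, y) = (0, b)
  inj : ∀ p q p' q', p < m → q < n → p' < m → q' < n → f (p, q) = f (p', q') → p = p' ∧ q = q'
  reach : ∀ p q p' q', p < m → q < n → p' < m → q' < n → ∃ k : ℕ, f^[k] (p, q) = (p', q')

/-- The natural-number coordinates of a square. -/
def coords {m n : ℕ} (s : Fin m × Fin n) : ℕ × ℕ := (s.1.val, s.2.val)

theorem coords_injective {m n : ℕ} : Function.Injective (coords (m := m) (n := n)) := by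
  rintro ⟨⟨a, _⟩, ⟨b, _⟩⟩ ⟨⟨c, _⟩, ⟨d, _⟩⟩ h
  simpa [coords] using h

theorem coords_stepEast {m n : ℕ} (s : Fin m × Fin n) :
    coords (stepEast s) = eastward m n (coords s) := by
  unfold stepEast eastward coords
  split_ifs <;> rfl

theorem coords_stepNorth {m n : ℕ} (s : Fin m × Fin n) :
    coords (stepNorth s) = northward m n (coords s) := by
  unfold stepNorth northward coords
  split_ifs <;> rfl

theorem IsHamiltonianPath.exists_closedTour {m n : ℕ} {b y : Fin n} {x : Fin m} {hm : 0 < m}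
    {l : List (Fin m × Fin n)}
    (h : IsHamiltonianPath (projectiveCheckerboard m n) (⟨0, hm⟩, b) (x, y) l) :
    ∃ f, ClosedTour m n b.val x.val y.val f := by
  obtain ⟨g, hg, hadj, hreach⟩ := h.exists_perm
  let f : ℕ × ℕ → ℕ × ℕ := fun s =>
    if h : s.1 < m ∧ s.2 < n then coords (g (⟨s.1, h.1⟩, ⟨s.2, h.2⟩)) else s
  have hf : ∀ s : Fin m × Fin n, f (coords s) = coords (g s) := by
    intro s
    exact dif_pos ⟨s.1.isLt, s.2.isLt⟩
  refine ⟨f, ?_, ?_, ?_, ?_⟩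
  · intro p q hp hq hne
    have hs : ((⟨p, hp⟩, ⟨q, hq⟩) : Fin m × Fin n) ≠ (x, y) := by
      intro hcon
      apply hne
      exact congrArg coords hcon
    have := hf (⟨p, hp⟩, ⟨q, hq⟩)
    rcases hadj _ hs with h | h
    · left
      rw [h, coords_stepEast] at this
      exact this
    · right
      rw [h, coords_stepNorth] at this
      exact this
  · have := hf (x, y)
    rw [hg] at this
    exact this
  · intro p q p' q' hp hq hp' hq' heq
    have h1 := hf (⟨p, hp⟩, ⟨q, hq⟩)
    have h2 := hf (⟨p', hp'⟩, ⟨q', hq'⟩)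
    have h3 := g.injective (coords_injective (h1.symm.trans (heq.trans h2)))
    simpa using h3
  · intro p q p' q' hp hq hp' hq'
    obtain ⟨k, hk⟩ := hreach (⟨p, hp⟩, ⟨q, hq⟩) (⟨p', hp'⟩, ⟨q', hq'⟩)
    have hsc : Function.Semiconj coords g f := fun s => (hf s).symm
    refine ⟨k, ?_⟩
    have := (hsc.iterate_right k) (⟨p, hp⟩, ⟨q, hq⟩)
    rw [hk] at this
    exact this.symm

theorem exists_isHamiltonianPath_of_tour {m n : ℕ} {b y : Fin n} {x : Fin m} {hm : 0 < m}
    (f : ℕ × ℕ → ℕ × ℕ)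
    (step : ∀ p q, p < m → q < n → (p, q) ≠ (x.val, y.val) →
      f (p, q) = eastward m n (p, q) ∨ f (p, q) = northward m n (p, q))
    (close : f (x.val, y.val) = (0, b.val))
    (inj : ∀ p q p' q', p < m → q < n → p' < m → q' < n →
      f (p, q) = f (p', q') → p = p' ∧ q = q')
    (reach : ∀ p q, p < m → q < n → ∃ k : ℕ, f^[k] (p, q) = (x.val, y.val)) :
    ∃ l, IsHamiltonianPath (projectiveCheckerboard m n) (⟨0, hm⟩, b) (x, y) l := by
  have hex : ∀ s : Fin m × Fin n, ∃ t : Fin m × Fin n, coords t = f (coords s) ∧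
      (s = (x, y) → t = (⟨0, hm⟩, b)) ∧
      (s ≠ (x, y) → (projectiveCheckerboard m n).Adj s t) := by
    intro s
    by_cases hs : s = (x, y)
    · exact ⟨(⟨0, hm⟩, b), by rw [hs]; exact close.symm, fun _ => rfl, fun h => absurd hs h⟩
    · rcases step s.1.val s.2.val s.1.isLt s.2.isLt
        (fun h => hs (coords_injective h)) with h | h
      · exact ⟨stepEast s, by rw [coords_stepEast]; exact h.symm, fun h => absurd h hs,
          fun _ => Or.inl rfl⟩
      · exact ⟨stepNorth s, by rw [coords_stepNorth]; exact h.symm, fun h => absurd h hs,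
          fun _ => Or.inr rfl⟩
  choose g hg hg1 hg2 using hex
  have hginj : Function.Injective g := by
    intro s t hst
    have := inj s.1.val s.2.val t.1.val t.2.val s.1.isLt s.2.isLt t.1.isLt t.2.isLt
      ((hg s).symm.trans ((congrArg coords hst).trans (hg t)))
    exact Prod.ext (Fin.ext this.1) (Fin.ext this.2)
  have hsc : Function.Semiconj coords g f := hg
  refine exists_isHamiltonianPath g (hg1 _ rfl) hg2 ?_
  refine reaches_of_injective hginj (v := (x, y)) ?_ _
  intro w
  obtain ⟨k, hk⟩ := reach w.1.val w.2.val w.1.isLt w.2.isLt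
  refine ⟨k, coords_injective ?_⟩
  exact ((hsc.iterate_right k) w).trans hk

/-! ### Orbits between visits to a level. -/

/-- One step of `f` from a square that does not lie on the level `c`. -/
def FlowStep (f : ℕ × ℕ → ℕ × ℕ) (c : ℕ) (s t : ℕ × ℕ) : Prop :=
  s.1 + s.2 ≠ c ∧ f s = t

/-- Iterating `f` leads from `s` to `t`, without leaving a square of the level `c`. -/
abbrev Flows (f : ℕ × ℕ → ℕ × ℕ) (c : ℕ) : ℕ × ℕ → ℕ × ℕ → Prop :=
  Relation.ReflTransGen (FlowStep f c)

theorem Flows.single {f : ℕ × ℕ → ℕ × ℕ} {c p q : ℕ} {t : ℕ × ℕ} (h : p + q ≠ c)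
    (hf : f (p, q) = t) : Flows f c (p, q) t :=
  Relation.ReflTransGen.single ⟨h, hf⟩

theorem Flows.iterate {f : ℕ × ℕ → ℕ × ℕ} {c : ℕ} {s t : ℕ × ℕ} (h : Flows f c s t) :
    ∃ k : ℕ, f^[k] s = t := by
  induction h with
  | refl => exact ⟨0, rfl⟩
  | tail _ hst ih =>
    obtain ⟨k, hk⟩ := ih
    exact ⟨k + 1, by rw [Function.iterate_succ_apply', hk, hst.2]⟩

/-- A set `B` of squares of the level `c` that is invariant under the first return map absorbs
all the iterates of `f` that lie on this level. -/
theorem mem_of_iterate {f : ℕ × ℕ → ℕ × ℕ} {c : ℕ} {B : Set (ℕ × ℕ)}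
    (hB : ∀ s ∈ B, ∃ t ∈ B, Flows f c (f s) t) {s t : ℕ × ℕ} (hs : s ∈ B)
    (h : ∃ k : ℕ, f^[k] s = t) (ht : t.1 + t.2 = c) : t ∈ B := by
  have key : ∀ k : ℕ, ∃ r ∈ B, Flows f c (f^[k] s) r := by
    intro k
    induction k with
    | zero => exact ⟨s, hs, .refl⟩
    | succ k ih =>
      obtain ⟨r, hr, hflow⟩ := ih
      rw [Function.iterate_succ_apply']
      rcases Relation.ReflTransGen.cases_head hflow with h | ⟨w, hw, hw'⟩
      · rw [h]
        exact hB r hr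
      · rw [hw.2]
        exact ⟨r, hr, hw'⟩
  obtain ⟨k, hk⟩ := h
  obtain ⟨r, hr, hflow⟩ := key k
  rw [hk] at hflow
  rcases Relation.ReflTransGen.cases_head hflow with h | ⟨w, hw, -⟩
  · rwa [h]
  · exact absurd ht hw.1

/-- If the flow from `s` returns to `s` without visiting the level `c`, then it never gets to
this level. -/
theorem not_iterate_of_cycle {f : ℕ × ℕ → ℕ × ℕ} {c : ℕ} {s t : ℕ × ℕ} (hsc : s.1 + s.2 ≠ c)
    (hs : Flows f c (f s) s) (ht : t.1 + t.2 = c) : ¬ ∃ k : ℕ, f^[k] s = t := by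
  have key : ∀ k : ℕ, Flows f c (f^[k] s) s := by
    intro k
    induction k with
    | zero => exact .refl
    | succ k ih =>
      rw [Function.iterate_succ_apply']
      rcases Relation.ReflTransGen.cases_head ih with h | ⟨w, hw, hw'⟩
      · rw [h]
        exact hs
      · rw [hw.2]
        exact hw'
  rintro ⟨k, hk⟩
  have := key k
  rw [hk] at this
  rcases Relation.ReflTransGen.cases_head this with h | ⟨w, hw, -⟩
  · exact hsc (h ▸ ht)
  · exact hw.1 ht

/-! ### Uniform diagonals and the outer corner. -/

/-- All squares of the `i`th diagonal travel east. -/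
def TravelsEast (m n : ℕ) (f : ℕ × ℕ → ℕ × ℕ) (i : ℕ) : Prop :=
  ∀ p q, p < m → q < n → (p + q = i ∨ p + q + i + 3 = m + n) → f (p, q) = eastward m n (p, q)

/-- All squares of the `i`th diagonal travel north. -/
def TravelsNorth (m n : ℕ) (f : ℕ × ℕ → ℕ × ℕ) (i : ℕ) : Prop :=
  ∀ p q, p < m → q < n → (p + q = i ∨ p + q + i + 3 = m + n) → f (p, q) = northward m n (p, q)

section Steps

variable {m n i : ℕ} {f : ℕ × ℕ → ℕ × ℕ}

theorem TravelsEast.inside (h : TravelsEast m n f i) {p q : ℕ} (hp : p + 1 < m) (hq : q < n)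
    (hi : p + q = i ∨ p + q + i + 3 = m + n) : f (p, q) = (p + 1, q) := by
  rw [h p q (by omega) hq hi]
  exact if_pos hp

theorem TravelsEast.wrap (h : TravelsEast m n f i) {p q : ℕ} (hp : p + 1 = m) (hq : q < n)
    (hi : p + q = i ∨ p + q + i + 3 = m + n) : f (p, q) = (0, n - 1 - q) := by
  rw [h p q (by omega) hq hi]
  exact if_neg (by simp only; omega)

theorem TravelsNorth.inside (h : TravelsNorth m n f i) {p q : ℕ} (hp : p < m) (hq : q + 1 < n)
    (hi : p + q = i ∨ p + q + i + 3 = m + n) : f (p, q) = (p, q + 1) := by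
  rw [h p q hp (by omega) hi]
  exact if_pos hq

theorem TravelsNorth.wrap (h : TravelsNorth m n f i) {p q : ℕ} (hp : p < m) (hq : q + 1 = n)
    (hi : p + q = i ∨ p + q + i + 3 = m + n) : f (p, q) = (m - 1 - p, 0) := by
  rw [h p q hp (by omega) hi]
  exact if_neg (by simp only; omega)

end Steps

/-- If the diagonals below `a` are uniform, the upper right corner of the board just carries
each of its squares to the antipodal one. -/
theorem flows_outer {m n a c : ℕ} {f : ℕ × ℕ → ℕ × ℕ} (hn : a + 2 ≤ n) (hm : n ≤ m)
    (hc : c + a + 3 = m + n)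
    (hout : ∀ i < a, TravelsEast m n f i ∨ TravelsNorth m n f i)
    (hcorner : f (m - 1, n - 1) = (0, 0)) :
    ∀ t ≤ a, ∀ u v, u + v = t → Flows f c (m - 1 - u, n - 1 - v) (u, v) := by
  intro t
  induction t with
  | zero =>
    intro _ u v huv
    obtain ⟨rfl, rfl⟩ : u = 0 ∧ v = 0 := by omega
    exact Flows.single (by omega) hcorner
  | succ t ih =>
    intro ht u v huv
    rcases hout t (by omega) with hE | hN
    · by_cases hu : u = 0
      · subst hu
        refine Flows.single (by omega) ?_
        rw [hE.wrap (by omega) (by omega) (by omega)]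
        congr 1; omega
      · refine (Flows.single (t := (m - 1 - (u - 1), n - 1 - v)) (by omega) ?_).trans
          ((ih (by omega) (u - 1) v (by omega)).trans (Flows.single (by omega) ?_))
        · rw [hE.inside (by omega) (by omega) (by omega)]
          congr 1; omega
        · rw [hE.inside (by omega) (by omega) (by omega)]
          congr 1; omega
    · by_cases hv : v = 0
      · subst hv
        refine Flows.single (by omega) ?_
        rw [hN.wrap (by omega) (by omega) (by omega)]
        congr 1; omega
      · refine (Flows.single (t := (m - 1 - u, n - 1 - (v - 1))) (by omega) ?_).trans
          ((ih (by omega) u (v - 1) (by omega)).trans (Flows.single (by omega) ?_))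
        · rw [hN.inside (by omega) (by omega) (by omega)]
          congr 1; omega
        · rw [hN.inside (by omega) (by omega) (by omega)]
          congr 1; omega

/-! ### The inner flow as a reversal of rows or columns. -/

/-- The level `i` flows to its antipodal level so that, up to the antipodal map, the rows
`0, …, K - 1` are reversed and the others are fixed. -/
def RowReversal (m n : ℕ) (f : ℕ × ℕ → ℕ × ℕ) (c i K : ℕ) : Prop :=
  ∀ p q p' q', p < m → q < n → p' < m → q' < n → p + q = i → p' + q' + i + 2 = m + n →
    (q + n = K + q' ∨ (K ≤ q ∧ q + q' + 1 = n)) → Flows f c (p, q) (p', q')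

/-- The analogue of `RowReversal` for columns. -/
def ColumnReversal (m n : ℕ) (f : ℕ × ℕ → ℕ × ℕ) (c i K : ℕ) : Prop :=
  ∀ p q p' q', p < m → q < n → p' < m → q' < n → p + q = i → p' + q' + i + 2 = m + n →
    (p + m = K + p' ∨ (K ≤ p ∧ p + p' + 1 = m)) → Flows f c (p, q) (p', q')

section Inner

variable {m n a c i K : ℕ} {f : ℕ × ℕ → ℕ × ℕ}

theorem rowReversal_middle (hi : 2 * i + 2 = m + n) : RowReversal m n f c i n := by
  intro p q p' q' _ _ _ _ _ _ h
  obtain ⟨rfl, rfl⟩ : p = p' ∧ q = q' := by omega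
  exact .refl

theorem TravelsEast.rowReversal_middle (hE : TravelsEast m n f i) (hnm : n ≤ m)
    (hi : 2 * i + 3 = m + n) (hc : i ≠ c) : RowReversal m n f c i n := by
  intro p q p' q' _ _ _ _ _ _ h
  refine Flows.single (by omega) ?_
  rw [hE.inside (by omega) (by omega) (by omega)]
  congr 1 <;> omega

/-- The antipodal level is `i + 1`, one step away. The top row wraps directly to its antipode, so it
is the one row that is not reversed. -/
theorem TravelsNorth.rowReversal_middle (hN : TravelsNorth m n f i)
    (hi : 2 * i + 3 = m + n) (hc : i ≠ c) : RowReversal m n f c i (n - 1) := by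
  intro p q p' q' _ _ _ _ _ _ h
  refine Flows.single (by omega) ?_
  by_cases hq : q + 1 < n
  · rw [hN.inside (by omega) hq (by omega)]
    congr 1 <;> omega
  · rw [hN.wrap (by omega) (by omega) (by omega)]
    congr 1 <;> omega

theorem TravelsEast.rowReversal (hE : TravelsEast m n f i) (hc : c + a + 3 = m + n) (hai : a < i)
    (hni : n ≤ i + 1) (hi : 2 * i + 4 ≤ m + n)
    (h : RowReversal m n f c (i + 1) K) : RowReversal m n f c i K := by
  intro p q p' q' hp hq hp' hq' hpq hpq' hK
  refine (Flows.single (t := (p + 1, q)) (by omega)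
    (hE.inside (by omega) (by omega) (by omega))).trans
    ((h (p + 1) q (p' - 1) q' (by omega) (by omega) (by omega) (by omega) (by omega) (by omega)
      hK).trans (Flows.single (by omega) ?_))
  rw [hE.inside (by omega) (by omega) (by omega)]
  congr 1; omega

/-- A north step at either end shifts the row by one, so `K` drops by 2. Row `K - 2` arrives in the
top row, wraps, and makes a second passage that brings it to its antipode. -/
theorem TravelsNorth.rowReversal (hN : TravelsNorth m n f i) (hc : c + a + 3 = m + n)
    (hai : a < i) (hnm : n ≤ m) (hi : 2 * i + 4 ≤ m + n) (hK2 : 2 ≤ K) (hKn : K ≤ n)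
    (h : RowReversal m n f c (i + 1) K) : RowReversal m n f c i (K - 2) := by
  intro p q p' q' hp hq hp' hq' hpq hpq' hK
  by_cases hq1 : q + 1 < n
  swap
  · refine Flows.single (by omega) ?_
    rw [hN.wrap (by omega) (by omega) (by omega)]
    congr 1 <;> omega
  have h1 : Flows f c (p, q) (p, q + 1) :=
    Flows.single (by omega) (hN.inside (by omega) (by omega) (by omega))
  have h2 : Flows f c (p', q' - 1) (p', q') := by
    refine Flows.single (by omega) ?_
    rw [hN.inside (by omega) (by omega) (by omega)]
    congr 1; omega
  by_cases hq2 : q + 2 = K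
  · have h3 : Flows f c (p, q + 1) (m - 2 - i, n - 1) :=
      h _ _ _ _ (by omega) (by omega) (by omega) (by omega) (by omega) (by omega) (by omega)
    have h4 : Flows f c (m - 2 - i, n - 1) (i + 1, 0) := by
      refine Flows.single (by omega) ?_
      rw [hN.wrap (by omega) (by omega) (by omega)]
      congr 1; omega
    have h5 : Flows f c (i + 1, 0) (p', q' - 1) :=
      h _ _ _ _ (by omega) (by omega) (by omega) (by omega) (by omega) (by omega) (by omega)
    exact h1.trans (h3.trans (h4.trans (h5.trans h2)))
  · exact h1.trans ((h _ _ _ _ (by omega) (by omega) (by omega) (by omega) (by omega) (by omega)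
      (by omega)).trans h2)

theorem TravelsEast.columnReversal (hE : TravelsEast m n f i) (hc : c + a + 3 = m + n)
    (hai : a < i) (hin : i + 2 ≤ n) (hnm : n ≤ m) (hK2 : 2 ≤ K)
    (h : ColumnReversal m n f c (i + 1) K) : ColumnReversal m n f c i (K - 2) := by
  intro p q p' q' hp hq hp' hq' hpq hpq' hK
  have h1 : Flows f c (p, q) (p + 1, q) :=
    Flows.single (by omega) (hE.inside (by omega) (by omega) (by omega))
  have h2 : Flows f c (p' - 1, q') (p', q') := by
    refine Flows.single (by omega) ?_
    rw [hE.inside (by omega) (by omega) (by omega)]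
    congr 1; omega
  by_cases hp2 : p + 2 = K
  · have h3 : Flows f c (p + 1, q) (m - 1, n - 2 - i) :=
      h _ _ _ _ (by omega) (by omega) (by omega) (by omega) (by omega) (by omega) (by omega)
    have h4 : Flows f c (m - 1, n - 2 - i) (0, i + 1) := by
      refine Flows.single (by omega) ?_
      rw [hE.wrap (by omega) (by omega) (by omega)]
      congr 1; omega
    have h5 : Flows f c (0, i + 1) (p' - 1, q') :=
      h _ _ _ _ (by omega) (by omega) (by omega) (by omega) (by omega) (by omega) (by omega)
    exact h1.trans (h3.trans (h4.trans (h5.trans h2)))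
  · exact h1.trans ((h _ _ _ _ (by omega) (by omega) (by omega) (by omega) (by omega) (by omega)
      (by omega)).trans h2)

end Inner

/-! ### The first return map to the level `c`. -/

/-- The squares `(m - 2 - a + v, n - 1 - v)`, `v ≤ a + 1`, of the level `c = m + n - 3 - a` flow,
once they have left this level, to the level `a + 1`; they get there in the row `v` if `v < z`,
in the row `a + 1` if `v = z`, and in the row `v - 1` if `z < v`. -/
structure FirstEntry (m n a c z : ℕ) (f : ℕ × ℕ → ℕ × ℕ) : Prop where
  le : z ≤ a + 1
  of_lt : ∀ v, v < z → Flows f c (f (m - 2 - a + v, n - 1 - v)) (a + 1 - v, v)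
  of_eq : Flows f c (f (m - 2 - a + z, n - 1 - z)) (0, a + 1)
  of_gt : ∀ v, z < v → v ≤ a + 1 → Flows f c (f (m - 2 - a + v, n - 1 - v)) (a + 2 - v, v - 1)

section FirstEntry

variable {m n a c x y z K : ℕ} {f : ℕ × ℕ → ℕ × ℕ}

theorem firstEntry_of_upper (hn : a + 2 ≤ n) (hm : n ≤ m) (hc : c + a + 3 = m + n)
    (hout : ∀ t ≤ a, ∀ u v, u + v = t → Flows f c (m - 1 - u, n - 1 - v) (u, v))
    (hz : z ≤ a + 1) (low : ∀ p q, p + q = a → f (p, q) = (p + 1, q))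
    (east : ∀ v, v < z → f (m - 2 - a + v, n - 1 - v) = (m - 1 - a + v, n - 1 - v))
    (close : f (m - 2 - a + z, n - 1 - z) = (0, a + 1))
    (north : ∀ v, z < v → v ≤ a + 1 → f (m - 2 - a + v, n - 1 - v) = (m - 2 - a + v, n - v)) :
    FirstEntry m n a c z f := by
  refine ⟨hz, ?_, ?_, ?_⟩
  · intro v hv
    rw [east v hv]
    have h := hout a le_rfl (a - v) v (by omega)
    rw [show m - 1 - (a - v) = m - 1 - a + v by omega] at h
    refine h.trans (Flows.single (by omega) ?_)
    rw [low _ _ (by omega)]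
    congr 1; omega
  · rw [close]
  · intro v hv hva
    rw [north v hv hva]
    have h := hout a le_rfl (a + 1 - v) (v - 1) (by omega)
    rw [show m - 1 - (a + 1 - v) = m - 2 - a + v by omega,
      show n - 1 - (v - 1) = n - v by omega] at h
    refine h.trans (Flows.single (by omega) ?_)
    rw [low _ _ (by omega)]
    congr 1; omega

/-- Here level `c` travels north and the split between east and north occurs on level `a`. The
composite through the corner has the same form as for a terminal square on level `c`, with `z = y +
1`. -/
theorem firstEntry_of_lower (hn : a + 2 ≤ n) (hm : n ≤ m) (hc : c + a + 3 = m + n)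
    (hout : ∀ t ≤ a, ∀ u v, u + v = t → Flows f c (m - 1 - u, n - 1 - v) (u, v))
    (hxy : x + y = a) (east : ∀ p q, p + q = a → p < x → f (p, q) = (p + 1, q))
    (close : f (x, y) = (0, a + 1))
    (north : ∀ p q, p + q = a → x < p → f (p, q) = (p, q + 1))
    (up : ∀ v, 0 < v → v ≤ a + 1 → f (m - 2 - a + v, n - 1 - v) = (m - 2 - a + v, n - v))
    (wrap : f (m - 2 - a, n - 1) = (a + 1, 0)) :
    FirstEntry m n a c (y + 1) f := by
  have key : ∀ v, 0 < v → v ≤ a + 1 →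
      Flows f c (f (m - 2 - a + v, n - 1 - v)) (f (a + 1 - v, v - 1)) := by
    intro v hv hva
    rw [up v hv hva]
    have h := hout a le_rfl (a + 1 - v) (v - 1) (by omega)
    rw [show m - 1 - (a + 1 - v) = m - 2 - a + v by omega,
      show n - 1 - (v - 1) = n - v by omega] at h
    exact h.trans (Flows.single (by omega) rfl)
  refine ⟨by omega, ?_, ?_, ?_⟩
  · intro v hv
    rcases Nat.eq_zero_or_pos v with rfl | hv0
    · rw [Nat.add_zero, Nat.sub_zero, wrap]
      exact .refl
    · have h := key v hv0 (by omega)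
      rw [north (a + 1 - v) (v - 1) (by omega) (by omega), Nat.sub_add_cancel hv0] at h
      exact h
  · have h := key (y + 1) (by omega) (by omega)
    rw [show a + 1 - (y + 1) = x by omega, Nat.add_sub_cancel, close] at h
    exact h
  · intro v hv hva
    have h := key v (by omega) hva
    rw [east (a + 1 - v) (v - 1) (by omega) (by omega), show a + 1 - v + 1 = a + 2 - v by omega] at h
    exact h

/-- A property of the squares of the level `m + n - 3 - a` that is invariant under the first
return map, and holds for one square, holds for all. -/
theorem forall_of_invariant (hn : a + 2 ≤ n) (hm : n ≤ m) (hc : c + a + 3 = m + n)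
    (hreach : ∀ v v', v ≤ a + 1 → v' ≤ a + 1 →
      ∃ k : ℕ, f^[k] (m - 2 - a + v, n - 1 - v) = (m - 2 - a + v', n - 1 - v'))
    (P : ℕ → Prop)
    (hP : ∀ v ≤ a + 1, P v → ∃ v' ≤ a + 1, P v' ∧
      Flows f c (f (m - 2 - a + v, n - 1 - v)) (m - 2 - a + v', n - 1 - v'))
    {v v' : ℕ} (hv : v ≤ a + 1) (hPv : P v) (hv' : v' ≤ a + 1) : P v' := by
  have := mem_of_iterate (c := c) (f := f)
    (B := {s | ∃ v ≤ a + 1, P v ∧ s = (m - 2 - a + v, n - 1 - v)}) ?_ ⟨v, hv, hPv, rfl⟩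
    (hreach v v' hv hv') (by simp only; omega)
  · obtain ⟨w, hw, hPw, heq⟩ := this
    have h1 := congrArg Prod.fst heq
    simp only at h1
    rwa [show v' = w by omega]
  · rintro s ⟨v, hv, hPv, rfl⟩
    obtain ⟨v', hv', hPv', hfl⟩ := hP v hv hPv
    exact ⟨_, ⟨v', hv', hPv', rfl⟩, hfl⟩

/-- For any other `z`, some nonempty set of positions omitting `z` is invariant under the return
map, contradicting transitivity. -/
theorem FirstEntry.eq_half (h : FirstEntry m n a c z f) (hn : a + 2 ≤ n) (hm : n ≤ m)
    (hc : c + a + 3 = m + n) (hR : RowReversal m n f c (a + 1) K) (hK : K ≤ a + 2)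
    (hreach : ∀ v v', v ≤ a + 1 → v' ≤ a + 1 →
      ∃ k : ℕ, f^[k] (m - 2 - a + v, n - 1 - v) = (m - 2 - a + v', n - 1 - v')) :
    z = K / 2 := by
  have hz := h.le
  have hR' : ∀ r v, r ≤ a + 1 → v ≤ a + 1 → (r + v + 1 = K ∨ (K ≤ r ∧ v = r)) →
      Flows f c (a + 1 - r, r) (m - 2 - a + v, n - 1 - v) := by
    intro r v hr hv hrv
    exact hR _ _ _ _ (by omega) (by omega) (by omega) (by omega) (by omega) (by omega) (by omega)
  rcases lt_or_ge (2 * z + 1) K with hlt | hge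
  -- Positions strictly above `z` drop to `v - 1`, and the reversal sends them to `K - v`, within
  -- the same interval.
  · have := forall_of_invariant hn hm hc hreach (fun v => z < v ∧ v + z + 1 ≤ K) ?_
      (v := z + 1) (v' := z) (by omega) (by omega) hz
    · omega
    · rintro v hv ⟨h1, h2⟩
      have h3 := h.of_gt v h1 hv
      rw [show a + 2 - v = a + 1 - (v - 1) by omega] at h3
      exact ⟨K - v, by omega, by omega, h3.trans (hR' _ _ (by omega) (by omega) (by omega))⟩
  · by_contra hne
    -- Positions below `z` keep their row; the second condition says that the reversed row `K - 1 -
    -- v` is again below `z`.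
    have := forall_of_invariant hn hm hc hreach (fun v => v < z ∧ (v < K → K < v + z + 1)) ?_
      (v := z - 1) (v' := z) (by omega) (by omega) hz
    · omega
    · rintro v hv ⟨h1, h2⟩
      have h3 := h.of_lt v h1
      rcases lt_or_ge v K with h4 | h4
      · exact ⟨K - 1 - v, by omega, by omega, h3.trans (hR' _ _ (by omega) (by omega) (by omega))⟩
      · exact ⟨v, by omega, by omega, h3.trans (hR' _ _ (by omega) (by omega) (by omega))⟩

/-- If `z > 0`, position 0 is a fixed point. If `z = 0` and `K ≥ 2`, the positions `v ≥ a + 3 - K`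
are permanently separated from 0. -/
theorem FirstEntry.eq_zero (h : FirstEntry m n a c z f) (hn : a + 2 ≤ n) (hm : n ≤ m)
    (hc : c + a + 3 = m + n) (hR : ColumnReversal m n f c (a + 1) K) (hK : K ≤ a + 1)
    (hreach : ∀ v v', v ≤ a + 1 → v' ≤ a + 1 →
      ∃ k : ℕ, f^[k] (m - 2 - a + v, n - 1 - v) = (m - 2 - a + v', n - 1 - v')) :
    z = 0 ∧ K ≤ 1 := by
  have hz := h.le
  have hR' : ∀ r v, r ≤ a + 1 → v ≤ a + 1 →
      (r + v + K = 2 * a + 3 ∨ (K + r ≤ a + 1 ∧ v = r)) →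
      Flows f c (a + 1 - r, r) (m - 2 - a + v, n - 1 - v) := by
    intro r v hr hv hrv
    exact hR _ _ _ _ (by omega) (by omega) (by omega) (by omega) (by omega) (by omega) (by omega)
  have hz0 : z = 0 := by
    by_contra hne
    have := forall_of_invariant hn hm hc hreach (fun v => v = 0) ?_
      (v := 0) (v' := z) (by omega) rfl hz
    · omega
    · rintro v hv rfl
      exact ⟨0, hv, rfl, (h.of_lt 0 (by omega)).trans (hR' _ _ (by omega) hv (by omega))⟩
  subst hz0
  refine ⟨rfl, ?_⟩
  by_contra hne
  have := forall_of_invariant hn hm hc hreach (fun v => a + 3 ≤ v + K) ?_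
    (v := a + 1) (v' := 0) le_rfl (by omega) (by omega)
  · omega
  · intro v hv h1
    have h3 := h.of_gt v (by omega) hv
    rw [show a + 2 - v = a + 1 - (v - 1) by omega] at h3
    exact ⟨2 * a + 4 - K - v, by omega, by omega,
      h3.trans (hR' _ _ (by omega) (by omega) (by omega))⟩

end FirstEntry

/-! ### Directions forced by injectivity. -/

theorem eastward_of_lt {m n p q : ℕ} (h : p + 1 < m) : eastward m n (p, q) = (p + 1, q) :=
  if_pos h

theorem eastward_of_eq {m n p q : ℕ} (h : p + 1 = m) : eastward m n (p, q) = (0, n - 1 - q) :=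
  if_neg (by simp only; omega)

theorem northward_of_lt {m n p q : ℕ} (h : q + 1 < n) : northward m n (p, q) = (p, q + 1) :=
  if_pos h

theorem northward_of_eq {m n p q : ℕ} (h : q + 1 = n) :
    northward m n (p, q) = (m - 1 - p, 0) :=
  if_neg (by simp only; omega)

namespace ClosedTour

variable {m n a b c x y : ℕ} {f : ℕ × ℕ → ℕ × ℕ}

theorem east_of_east (T : ClosedTour m n b x y f) {p q p' q' : ℕ} (hp : p < m) (hq : q < n)
    (hp' : p' < m) (hq' : q' < n) (h : f (p, q) = eastward m n (p, q))
    (heq : eastward m n (p, q) = northward m n (p', q')) (hne : p ≠ p' ∨ q ≠ q')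
    (hτ : ¬ (p' = x ∧ q' = y)) : f (p', q') = eastward m n (p', q') := by
  rcases T.step p' q' hp' hq' (fun h => hτ (by simpa using h)) with h1 | h1
  · exact h1
  · have := T.inj p q p' q' hp hq hp' hq' (h.trans (heq.trans h1.symm))
    omega

theorem north_of_north (T : ClosedTour m n b x y f) {p q p' q' : ℕ} (hp : p < m) (hq : q < n)
    (hp' : p' < m) (hq' : q' < n) (h : f (p', q') = northward m n (p', q'))
    (heq : eastward m n (p, q) = northward m n (p', q')) (hne : p ≠ p' ∨ q ≠ q')
    (hτ : ¬ (p = x ∧ q = y)) : f (p, q) = northward m n (p, q) := by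
  rcases T.step p q hp hq (fun h => hτ (by simpa using h)) with h1 | h1
  · have := T.inj p q p' q' hp hq hp' hq' (h1.trans (heq.trans h.symm))
    omega
  · exact h1

theorem east_of_east_left (T : ClosedTour m n b x y f) {p q : ℕ} (hτ : x + y ≠ p + q)
    (hq : q < n) (h : f (p, q) = eastward m n (p, q)) :
    ∀ k, p + k < m → k ≤ q → f (p + k, q - k) = eastward m n (p + k, q - k) := by
  intro k
  induction k with
  | zero => intros; exact h
  | succ k ih =>
    intro hp hk
    refine T.east_of_east (p := p + k) (q := q - k) (by omega) (by omega) (by omega) (by omega)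
      (ih (by omega) (by omega)) ?_ (by omega) (by omega)
    rw [eastward_of_lt (by omega), northward_of_lt (by omega)]
    congr 1; omega

/-- East travel spreads down to the right end of level `i`, whose east neighbour is the north
neighbour of the left end of level `j`, and then along level `j`. -/
theorem east_of_east_other (T : ClosedTour m n b x y f) (hn : 2 ≤ n) (hm : n ≤ m) {i j : ℕ}
    (hij : i + j + 3 = m + n) (hi : x + y ≠ i) (hj : x + y ≠ j) {p q p' q' : ℕ}
    (hp : p < m) (hq : q < n) (hp' : p' < m) (hq' : q' < n)
    (hpq : p + q = i) (hpq' : p' + q' = j) (h : f (p, q) = eastward m n (p, q)) :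
    f (p', q') = eastward m n (p', q') := by
  have hend := T.east_of_east_left (by omega) hq h (min i (m - 1) - p) (by omega) (by omega)
  have hstart : f (j + 1 - n, j - (j + 1 - n)) = eastward m n (j + 1 - n, j - (j + 1 - n)) := by
    refine T.east_of_east (by omega) (by omega) (by omega) (by omega) hend ?_ (by omega) (by omega)
    rcases lt_or_ge (i + 1) m with hi | hi
    · rw [eastward_of_lt (by omega), northward_of_eq (by omega)]
      congr 1 <;> omega
    · rw [eastward_of_eq (by omega), northward_of_lt (by omega)]
      congr 1 <;> omega
  have := T.east_of_east_left (by omega) (by omega) hstart (p' - (j + 1 - n)) (by omega) (by omega)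
  rwa [show j + 1 - n + (p' - (j + 1 - n)) = p' by omega,
    show j - (j + 1 - n) - (p' - (j + 1 - n)) = q' by omega] at this

theorem travels (T : ClosedTour m n b x y f) (hn : 2 ≤ n) (hm : n ≤ m) {i : ℕ}
    (hi : 2 * i + 3 ≤ m + n) (h1 : x + y ≠ i) (h2 : x + y + i + 3 ≠ m + n) :
    TravelsEast m n f i ∨ TravelsNorth m n f i := by
  by_cases hex : ∃ p q, p < m ∧ q < n ∧ (p + q = i ∨ p + q + i + 3 = m + n) ∧
      f (p, q) = eastward m n (p, q)
  · left
    obtain ⟨p, q, hp, hq, hpq, h⟩ := hex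
    intro p' q' hp' hq' hpq'
    -- Two squares of the same level are compared through the other level of the diagonal.
    by_cases hs : p + q + (p' + q') + 3 = m + n
    · exact T.east_of_east_other hn hm hs (by omega) (by omega) hp hq hp' hq' rfl rfl h
    · obtain ⟨u, v, hu, hv, huv⟩ : ∃ u v, u < m ∧ v < n ∧ p + q + (u + v) + 3 = m + n :=
        ⟨min (m + n - 3 - (p + q)) (m - 1),
          m + n - 3 - (p + q) - min (m + n - 3 - (p + q)) (m - 1), by omega, by omega, by omega⟩
      exact T.east_of_east_other hn hm (i := u + v) (j := p' + q') (by omega) (by omega)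
        (by omega) hu hv hp' hq' rfl rfl
        (T.east_of_east_other hn hm huv (by omega) (by omega) hp hq hu hv rfl rfl h)
  · right
    intro p q hp hq hpq
    rcases T.step p q hp hq (fun h => by simp only [Prod.mk.injEq] at h; omega) with h | h
    · exact absurd ⟨p, q, hp, hq, hpq, h⟩ hex
    · exact h

/-- A north step from `(0, a)` would hit the initial square, already the image of the terminal one.
So `(0, a)` goes east, and this propagates along the diagonal until the terminal square interrupts
it. -/
theorem lower_east (T : ClosedTour m n (a + 1) x y f) (hn : a + 2 ≤ n) (hn3 : 3 ≤ n)
    (hm : n ≤ m) (hx : x < m) (hy : y < n) :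
    ∀ p q, p + q = a → (x + y = a → p < x) → f (p, q) = (p + 1, q) := by
  intro p
  induction p with
  | zero =>
    intro q hq h
    rcases T.step 0 q (by omega) (by omega)
      (fun h => by simp only [Prod.mk.injEq] at h; omega) with h1 | h1
    · rw [h1, eastward_of_lt (by omega)]
    · rw [northward_of_lt (by omega), show q + 1 = a + 1 by omega, ← T.close] at h1
      have := T.inj _ _ _ _ (by omega) (by omega) hx hy h1
      omega
  | succ p ih =>
    intro q hq h
    rw [← eastward_of_lt (m := m) (n := n) (p := p + 1) (q := q) (by omega)]
    refine T.east_of_east (p := p) (q := q + 1) (by omega) (by omega) (by omega) (by omega)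
      ?_ ?_ (by omega) (by omega)
    · rw [ih _ (by omega) (by omega), eastward_of_lt (by omega)]
    · rw [eastward_of_lt (by omega), northward_of_lt (by omega)]

theorem upper_east (T : ClosedTour m n (a + 1) x y f) (hn : a + 2 ≤ n) (hn3 : 3 ≤ n)
    (hm : n ≤ m) (hx : x < m) (hy : y < n)
    (ha : x + y ≠ a) : ∀ v ≤ a + 1, (x + y + a + 3 = m + n → m - 2 - a + v < x) →
    f (m - 2 - a + v, n - 1 - v) = eastward m n (m - 2 - a + v, n - 1 - v) := by
  intro v
  induction v with
  | zero =>
    intro _ h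
    refine T.east_of_east (p := a) (q := 0) (by omega) (by omega) (by omega) (by omega)
      ?_ ?_ (by omega) (by omega)
    · rw [lower_east T hn hn3 hm hx hy a 0 (by omega) (by omega), eastward_of_lt (by omega)]
    · rw [eastward_of_lt (by omega), northward_of_eq (by omega)]
      congr 1; omega
  | succ v ih =>
    intro hv h
    refine T.east_of_east (by omega) (by omega) (by omega) (by omega)
      (ih (by omega) (by omega)) ?_ (by omega) (by omega)
    rw [eastward_of_lt (by omega), northward_of_lt (by omega)]
    congr 1; omega

/-- Propagation from the opposite end: an east step from `(m - 1, n - 2 - a)` would hit the initial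
square. -/
theorem upper_north (T : ClosedTour m n (a + 1) x y f) (hn : a + 2 ≤ n)
    (hm : n ≤ m) (hx : x < m) (hy : y < n) : ∀ k ≤ a + 1, (x + y + a + 3 = m + n → x + k + 1 < m) →
    f (m - 1 - k, n + k - 2 - a) = northward m n (m - 1 - k, n + k - 2 - a) := by
  intro k
  induction k with
  | zero =>
    intro _ h
    rcases T.step (m - 1) (n - 2 - a) (by omega) (by omega)
      (fun h => by simp only [Prod.mk.injEq] at h; omega) with h1 | h1
    · rw [eastward_of_eq (by omega), show n - 1 - (n - 2 - a) = a + 1 by omega, ← T.close] at h1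
      have := T.inj _ _ _ _ (by omega) (by omega) hx hy h1
      omega
    · exact h1
  | succ k ih =>
    intro hk h
    refine T.north_of_north (by omega) (by omega) (by omega) (by omega)
      (ih (by omega) (by omega)) ?_ (by omega) (by omega)
    rw [eastward_of_lt (by omega), northward_of_lt (by omega)]
    congr 1 <;> omega

theorem lower_north (T : ClosedTour m n (a + 1) x y f) (hn : a + 2 ≤ n) (hn3 : 3 ≤ n)
    (hm : n ≤ m) (hx : x < m) (hy : y < n)
    (hc : x + y + a + 3 ≠ m + n) : ∀ q p, p + q = a → (x + y = a → x < p) →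
    f (p, q) = (p, q + 1) := by
  intro q
  induction q with
  | zero =>
    intro p hp h
    rw [← northward_of_lt (m := m) (n := n) (p := p) (q := 0) (by omega)]
    refine T.north_of_north (p' := m - 2 - a) (q' := n - 1) (by omega) (by omega) (by omega)
      (by omega) ?_ ?_ (by omega) (by omega)
    · have := T.upper_north hn hm hx hy (a + 1) le_rfl (by omega)
      rwa [show m - 1 - (a + 1) = m - 2 - a by omega,
        show n + (a + 1) - 2 - a = n - 1 by omega] at this
    · rw [eastward_of_lt (by omega), northward_of_eq (by omega)]
      congr 1; omega
  | succ q ih =>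
    intro p hp h
    rw [← northward_of_lt (m := m) (n := n) (p := p) (q := q + 1) (by omega)]
    refine T.north_of_north (p' := p + 1) (q' := q) (by omega) (by omega) (by omega)
      (by omega) ?_ ?_ (by omega) (by omega)
    · rw [ih _ (by omega) (by omega), northward_of_lt (by omega)]
    · rw [eastward_of_lt (by omega), northward_of_lt (by omega)]

/-- Otherwise nothing interrupts the east travel started at `(0, a)`, and it reaches the other
predecessor of the initial square. -/
theorem terminal_mem (T : ClosedTour m n (a + 1) x y f) (hn : a + 2 ≤ n) (hn3 : 3 ≤ n)
    (hm : n ≤ m) (hx : x < m) (hy : y < n) : x + y = a ∨ x + y + a + 3 = m + n := by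
  by_contra hcon
  have h1 := T.upper_east hn hn3 hm hx hy (by omega) (a + 1) le_rfl (by omega)
  rw [eastward_of_eq (by omega), show n - 1 - (n - 1 - (a + 1)) = a + 1 by omega, ← T.close] at h1
  have := T.inj _ _ _ _ (by omega) (by omega) hx hy h1
  omega

theorem firstEntry (T : ClosedTour m n (a + 1) x y f) (hn : a + 2 ≤ n) (hn3 : 3 ≤ n)
    (hm : n ≤ m) (hx : x < m) (hy : y < n)
    (hc : c + a + 3 = m + n) :
    (x + y = a ∧ FirstEntry m n a c (y + 1) f) ∨
      (x + y + a + 3 = m + n ∧ FirstEntry m n a c (n - 1 - y) f) := by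
  have hmem := T.terminal_mem hn hn3 hm hx hy
  -- Both moves from this corner lead to `(0, 0)`.
  have hcorner : f (m - 1, n - 1) = (0, 0) := by
    rcases T.step (m - 1) (n - 1) (by omega) (by omega)
      (fun h => by simp only [Prod.mk.injEq] at h; omega) with h | h
    · rw [h, eastward_of_eq (by omega)]
      congr 1; omega
    · rw [h, northward_of_eq (by omega)]
      congr 1; omega
  have hout := flows_outer hn hm hc
    (fun i hi => T.travels (i := i) (by omega) hm (by omega) (by omega) (by omega)) hcorner
  rcases hmem with h | h
  · refine Or.inl ⟨h, firstEntry_of_lower hn hm hc hout h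
      (fun p q hpq hpx => T.lower_east hn hn3 hm hx hy p q hpq (fun _ => hpx)) T.close
      (fun p q hpq hpx => T.lower_north hn hn3 hm hx hy (by omega) q p hpq (fun _ => hpx)) ?_ ?_⟩
    · intro v hv hva
      have := T.upper_north hn hm hx hy (a + 1 - v) (by omega) (by omega)
      rw [show m - 1 - (a + 1 - v) = m - 2 - a + v by omega,
        show n + (a + 1 - v) - 2 - a = n - 1 - v by omega, northward_of_lt (by omega)] at this
      rw [this]
      congr 1; omega
    · have := T.upper_north hn hm hx hy (a + 1) le_rfl (by omega)
      rw [show m - 1 - (a + 1) = m - 2 - a by omega,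
        show n + (a + 1) - 2 - a = n - 1 by omega, northward_of_eq (by omega)] at this
      rw [this]
      congr 1; omega
  · refine Or.inr ⟨h, firstEntry_of_upper hn hm hc hout (by omega)
      (fun p q hpq => T.lower_east hn hn3 hm hx hy p q hpq (by omega)) ?_ ?_ ?_⟩
    · intro v hv
      rw [T.upper_east hn hn3 hm hx hy (by omega) v (by omega) (by omega),
        eastward_of_lt (by omega)]
      congr 1; omega
    · rw [← T.close]
      congr 2 <;> omega
    · intro v hv hva
      have := T.upper_north hn hm hx hy (a + 1 - v) (by omega) (by omega)
      rw [show m - 1 - (a + 1 - v) = m - 2 - a + v by omega,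
        show n + (a + 1 - v) - 2 - a = n - 1 - v by omega, northward_of_lt (by omega)] at this
      rw [this]
      congr 1; omega

end ClosedTour

/-! ### Bounds from the exclusion of short cycles. -/

namespace ClosedTour

variable {m n a b c x y i K : ℕ} {f : ℕ × ℕ → ℕ × ℕ}

/-- The wrap from `(m - 2 - i, n - 1)` to `(i + 1, 0)` would close a cycle that misses the level
`c`. -/
theorem not_flows_of_travelsNorth (T : ClosedTour m n b x y f) (hn : a + 2 ≤ n) (hm : n ≤ m)
    (hc : c + a + 3 = m + n) (hai : a < i) (hi : 2 * i + 4 ≤ m + n) (hN : TravelsNorth m n f i) :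
    ¬ Flows f c (i + 1, 0) (m - 2 - i, n - 1) := by
  intro h
  refine not_iterate_of_cycle (c := c) (s := (m - 2 - i, n - 1)) (t := (m - 2 - a, n - 1))
    (by simp only; omega) ?_ (by simp only; omega)
    (T.reach _ _ _ _ (by omega) (by omega) (by omega) (by omega))
  rw [hN.wrap (by omega) (by omega) (by omega), show m - 1 - (m - 2 - i) = i + 1 by omega]
  exact h

theorem not_flows_of_travelsEast (T : ClosedTour m n b x y f) (hm : n ≤ m)
    (hc : c + a + 3 = m + n) (hai : a < i) (hi : i + 2 ≤ n) (hE : TravelsEast m n f i) :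
    ¬ Flows f c (0, i + 1) (m - 1, n - 2 - i) := by
  intro h
  refine not_iterate_of_cycle (c := c) (s := (m - 1, n - 2 - i)) (t := (m - 2 - a, n - 1))
    (by simp only; omega) ?_ (by simp only; omega)
    (T.reach _ _ _ _ (by omega) (by omega) (by omega) (by omega))
  rw [hE.wrap (by omega) (by omega) (by omega), show n - 1 - (n - 2 - i) = i + 1 by omega]
  exact h

theorem rowReversal_of_travelsNorth (T : ClosedTour m n b x y f) (hn : a + 2 ≤ n) (hm : n ≤ m)
    (hc : c + a + 3 = m + n) (hai : a < i) (hi : 2 * i + 4 ≤ m + n) (hN : TravelsNorth m n f i)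
    (hKn : K ≤ n) (h : RowReversal m n f c (i + 1) K) :
    2 ≤ K ∧ RowReversal m n f c i (K - 2) := by
  have hK : 2 ≤ K := by
    by_contra hK
    exact T.not_flows_of_travelsNorth hn hm hc hai hi hN
      (h _ _ _ _ (by omega) (by omega) (by omega) (by omega) (by omega) (by omega) (by omega))
  exact ⟨hK, hN.rowReversal hc hai hm hi hK hKn h⟩

/-- The lower bound on `K` holds because each diagonal costs at most 2. -/
theorem exists_rowReversal_of_le (T : ClosedTour m n b x y f) (hn : a + 2 ≤ n) (hm : n ≤ m)
    (hc : c + a + 3 = m + n)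
    (hin : ∀ i, a < i → 2 * i + 3 ≤ m + n → TravelsEast m n f i ∨ TravelsNorth m n f i) :
    ∀ j i, i + j = (m + n - 2) / 2 → n ≤ i + 1 →
      ∃ K, RowReversal m n f c i K ∧ K ≤ n ∧ 2 * i + 2 ≤ m + K := by
  intro j
  induction j with
  | zero =>
    intro i hi _
    by_cases hpar : 2 * i + 2 = m + n
    · exact ⟨n, rowReversal_middle hpar, le_rfl, by omega⟩
    · rcases hin i (by omega) (by omega) with hE | hN
      · exact ⟨n, hE.rowReversal_middle hm (by omega) (by omega), le_rfl, by omega⟩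
      · exact ⟨n - 1, hN.rowReversal_middle (by omega) (by omega), by omega, by omega⟩
  | succ j ih =>
    intro i hi hni
    obtain ⟨K, hR, hKn, hK⟩ := ih (i + 1) (by omega) (by omega)
    rcases hin i (by omega) (by omega) with hE | hN
    · exact ⟨K, hE.rowReversal hc (by omega) hni (by omega) hR, hKn, by omega⟩
    · obtain ⟨hK2, hR'⟩ := T.rowReversal_of_travelsNorth hn hm hc (by omega) (by omega) hN hKn hR
      exact ⟨K - 2, hR', by omega, by omega⟩

/-- Below level `n - 1`, an east diagonal can wrap from the right edge to the left one, so from a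
row reversal it is allowed only if the whole next level is reversed. Size forces this at level `n -
1` with `K = n`; from then on columns are reversed and every diagonal must go east. -/
theorem exists_reversal (T : ClosedTour m n b x y f) (hn : a + 2 ≤ n) (hm : n ≤ m)
    (hc : c + a + 3 = m + n)
    (hin : ∀ i, a < i → 2 * i + 3 ≤ m + n → TravelsEast m n f i ∨ TravelsNorth m n f i) :
    ∀ j i, i + j + 1 = n → a < i →
      (∃ K, RowReversal m n f c i K ∧ K + 2 * j ≤ n ∧ 2 * n ≤ K + 2 * j + m) ∨
      (0 < j ∧ ∃ K, ColumnReversal m n f c i K ∧ K + 2 * j = n) := by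
  intro j
  induction j with
  | zero =>
    intro i hi _
    obtain ⟨K, hR, hKn, hK⟩ := T.exists_rowReversal_of_le hn hm hc hin
      ((m + n - 2) / 2 - i) i (by omega) (by omega)
    exact Or.inl ⟨K, hR, by omega, by omega⟩
  | succ j ih =>
    intro i hi hai
    rcases ih (i + 1) (by omega) (by omega) with ⟨K, hR, hKn, hK⟩ | ⟨hj, K, hR, hK⟩
    · rcases hin i hai (by omega) with hE | hN
      · right
        refine ⟨by omega, ?_⟩
        have hKi : K = i + 2 := by
          by_contra hne
          exact T.not_flows_of_travelsEast hm hc hai (by omega) hE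
            (hR _ _ _ _ (by omega) (by omega) (by omega) (by omega) (by omega) (by omega)
              (by omega))
        -- Reversing all rows of a level is the same as reversing all its columns.
        have hC : ColumnReversal m n f c (i + 1) K := fun p q p' q' hp hq hp' hq' h1 h2 h3 =>
          hR p q p' q' hp hq hp' hq' h1 h2 (by omega)
        exact ⟨K - 2, hE.columnReversal hc hai (by omega) hm (by omega) hC, by omega⟩
      · left
        obtain ⟨hK2, hR'⟩ := T.rowReversal_of_travelsNorth hn hm hc hai (by omega) hN
          (by omega) hR
        exact ⟨K - 2, hR', by omega, by omega⟩
    · rcases hin i hai (by omega) with hE | hN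
      · right
        have hK2 : 2 ≤ K := by
          by_contra hK2
          exact T.not_flows_of_travelsEast hm hc hai (by omega) hE
            (hR _ _ _ _ (by omega) (by omega) (by omega) (by omega) (by omega) (by omega)
              (by omega))
        exact ⟨by omega, K - 2, hE.columnReversal hc hai (by omega) hm hK2 hR, by omega⟩
      -- Since `0 < j`, column `i + 1` is not reversed, so `(i + 1, 0)` flows to its antipode.
      · exact absurd (hR _ _ _ _ (by omega) (by omega) (by omega) (by omega) (by omega)
          (by omega) (by omega)) (T.not_flows_of_travelsNorth hn hm hc hai (by omega) hN)

theorem firstEntry_bounds {z : ℕ} (T : ClosedTour m n b x y f) (hn : a + 2 ≤ n) (hm : n ≤ m)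
    (hc : c + a + 3 = m + n)
    (hin : ∀ i, a < i → 2 * i + 3 ≤ m + n → TravelsEast m n f i ∨ TravelsNorth m n f i)
    (h : FirstEntry m n a c z f) : 2 * z + n ≤ 2 * a + 4 ∧ 2 * a + 3 ≤ m + 2 * z := by
  have hreach : ∀ v v', v ≤ a + 1 → v' ≤ a + 1 →
      ∃ k : ℕ, f^[k] (m - 2 - a + v, n - 1 - v) = (m - 2 - a + v', n - 1 - v') :=
    fun v v' hv hv' => T.reach _ _ _ _ (by omega) (by omega) (by omega) (by omega)
  rcases T.exists_reversal hn hm hc hin (n - 2 - a) (a + 1) (by omega) (by omega) with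
    ⟨K, hR, h1, h2⟩ | ⟨hj, K, hR, h1⟩
  · have := h.eq_half hn hm hc hR (by omega) hreach
    omega
  · have := h.eq_zero hn hm hc hR (by omega) hreach
    omega

/-- The terminal square of a tour lies on the diagonal `a`, and its position `z` there is bounded
on both sides. -/
theorem terminal_bounds (T : ClosedTour m n (a + 1) x y f) (hn : a + 2 ≤ n) (hn3 : 3 ≤ n)
    (hm : n ≤ m) (hx : x < m) (hy : y < n) :
    ∃ z, ((x + y = a ∧ z = y + 1) ∨ (x + y + a + 3 = m + n ∧ z + y + 1 = n)) ∧
      2 * z + n ≤ 2 * a + 4 ∧ 2 * a + 3 ≤ m + 2 * z := by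
  have hmem := T.terminal_mem hn hn3 hm hx hy
  have hin : ∀ i, a < i → 2 * i + 3 ≤ m + n → TravelsEast m n f i ∨ TravelsNorth m n f i :=
    fun i hai hi => T.travels (by omega) hm hi (by omega) (by omega)
  have hc : m + n - 3 - a + a + 3 = m + n := by omega
  rcases T.firstEntry hn hn3 hm hx hy hc with ⟨h, hF⟩ | ⟨h, hF⟩
  · exact ⟨_, Or.inl ⟨h, rfl⟩, T.firstEntry_bounds hn hm hc hin hF⟩
  · exact ⟨_, Or.inr ⟨h, by omega⟩, T.firstEntry_bounds hn hm hc hin hF⟩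

end ClosedTour

/-! ### Reachability in the constructed flow. -/

theorem exists_iterate_trans {f : ℕ × ℕ → ℕ × ℕ} {r s t : ℕ × ℕ} (h : ∃ k : ℕ, f^[k] r = s)
    (h' : ∃ k : ℕ, f^[k] s = t) : ∃ k : ℕ, f^[k] r = t := by
  obtain ⟨k, rfl⟩ := h
  obtain ⟨l, rfl⟩ := h'
  exact ⟨l + k, Function.iterate_add_apply _ _ _ _⟩

theorem exists_iterate_of_flows {f : ℕ × ℕ → ℕ × ℕ} {c : ℕ} {s t : ℕ × ℕ}
    (h : Flows f c (f s) t) : ∃ k : ℕ, f^[k] s = t :=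
  exists_iterate_trans ⟨1, rfl⟩ h.iterate

/-- All squares between the level `i` and its antipodal level flow to the latter. -/
def FlowsUp (m n : ℕ) (f : ℕ × ℕ → ℕ × ℕ) (c i : ℕ) : Prop :=
  ∀ p q, p < m → q < n → i ≤ p + q → p + q + i + 2 ≤ m + n →
    ∃ p' q', p' < m ∧ q' < n ∧ p' + q' + i + 2 = m + n ∧ Flows f c (p, q) (p', q')

section

variable {m n a c x y z i k K : ℕ} {f : ℕ × ℕ → ℕ × ℕ}

theorem RowReversal.exists_flows (h : RowReversal m n f c i K) (him : i < m) (hKn : K ≤ n)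
    (hKi : K ≤ i + 1) {p q : ℕ} (hp : p < m) (hq : q < n) (hpq : p + q = i) :
    ∃ p' q', p' < m ∧ q' < n ∧ p' + q' + i + 2 = m + n ∧ Flows f c (p, q) (p', q') := by
  rcases lt_or_ge q K with hqK | hqK
  · exact ⟨m + K - 2 - i - q, q + n - K, by omega, by omega, by omega,
      h _ _ _ _ hp hq (by omega) (by omega) hpq (by omega) (by omega)⟩
  · exact ⟨m - 1 - p, n - 1 - q, by omega, by omega, by omega,
      h _ _ _ _ hp hq (by omega) (by omega) hpq (by omega) (by omega)⟩

theorem RowReversal.flowsUp_middle (h : RowReversal m n f c i K) (him : i < m) (hKn : K ≤ n)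
    (hKi : K ≤ i + 1) (hi : m + n ≤ 2 * i + 3) : FlowsUp m n f c i := by
  intro p q hp hq h1 h2
  by_cases hpq : p + q = i
  · exact h.exists_flows him hKn hKi hp hq hpq
  · exact ⟨p, q, hp, hq, by omega, .refl⟩

theorem TravelsEast.flowsUp (hE : TravelsEast m n f i) (hR : RowReversal m n f c i K)
    (him : i < m) (hKn : K ≤ n) (hKi : K ≤ i + 1) (hni : n ≤ i + 1) (hic : i + c + 3 ≠ m + n)
    (h : FlowsUp m n f c (i + 1)) : FlowsUp m n f c i := by
  intro p q hp hq h1 h2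
  by_cases hpq : p + q = i
  · exact hR.exists_flows him hKn hKi hp hq hpq
  by_cases hpq' : p + q + i + 2 = m + n
  · exact ⟨p, q, hp, hq, hpq', .refl⟩
  obtain ⟨p', q', hp', hq', h3, h4⟩ := h p q hp hq (by omega) (by omega)
  exact ⟨p' + 1, q', by omega, hq', by omega, h4.trans (Flows.single (by omega)
    (hE.inside (by omega) (by omega) (by omega)))⟩

theorem TravelsNorth.flowsUp (hN : TravelsNorth m n f i) (hR : RowReversal m n f c i (K - 2))
    (hR' : RowReversal m n f c (i + 1) K) (hnm : n ≤ m) (hi : 2 * i + 4 ≤ m + n) (hK2 : 2 ≤ K)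
    (hKn : K ≤ n) (hKi : K ≤ i + 2) (hic : i + c + 3 ≠ m + n)
    (h : FlowsUp m n f c (i + 1)) : FlowsUp m n f c i := by
  intro p q hp hq h1 h2
  by_cases hpq : p + q = i
  · exact hR.exists_flows (by omega) (by omega) (by omega) hp hq hpq
  by_cases hpq' : p + q + i + 2 = m + n
  · exact ⟨p, q, hp, hq, hpq', .refl⟩
  obtain ⟨p', q', hp', hq', h3, h4⟩ := h p q hp hq (by omega) (by omega)
  by_cases hq1 : q' + 1 < n
  · exact ⟨p', q' + 1, hp', hq1, by omega, h4.trans (Flows.single (by omega)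
      (hN.inside (by omega) (by omega) (by omega)))⟩
  -- A top-row square wraps and makes one more passage, ending in row `n - K`; since `2 ≤ K`, it can
  -- then step north.
  · have h5 : Flows f c (p', q') (i + 1, 0) := by
      refine Flows.single (by omega) ?_
      rw [hN.wrap (by omega) (by omega) (by omega)]
      congr 1; omega
    have h6 : Flows f c (i + 1, 0) (m + K - 3 - i, n - K) :=
      hR' _ _ _ _ (by omega) (by omega) (by omega) (by omega) (by omega) (by omega) (by omega)
    have h7 : Flows f c (m + K - 3 - i, n - K) (m + K - 3 - i, n - K + 1) :=
      Flows.single (by omega) (hN.inside (by omega) (by omega) (by omega))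
    exact ⟨_, _, by omega, by omega, by omega, h4.trans (h5.trans (h6.trans h7))⟩

/-- If the diagonals `a + 1, …, n + k - 2` travel north and the later ones travel east, then the
level `i` of the board is reversed on `K` rows, where `K / 2 = n / 2 - (n - 1 + k - i)`. -/
theorem exists_rowReversal_flowsUp (hn : a + 2 ≤ n) (hm : n ≤ m) (hc : c + a + 3 = m + n)
    (hk : n - 2 - a + k ≤ n / 2) (hkm : k + (n + 1) / 2 ≤ (m + 1) / 2)
    (hE : ∀ i, n + k ≤ i + 1 → 2 * i + 3 ≤ m + n → TravelsEast m n f i)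
    (hN : ∀ i, a < i → i + 1 < n + k → 2 * i + 3 ≤ m + n → TravelsNorth m n f i) :
    ∀ j i, i + j = (m + n - 2) / 2 → a < i → ∃ K, RowReversal m n f c i K ∧
      FlowsUp m n f c i ∧ K ≤ n ∧ K / 2 + (n - 1 + k - i) = n / 2 := by
  intro j
  induction j with
  | zero =>
    intro i hi hai
    by_cases hpar : 2 * i + 2 = m + n
    · have hR := rowReversal_middle (c := c) (f := f) hpar
      exact ⟨n, hR, hR.flowsUp_middle (by omega) le_rfl (by omega) (by omega), le_rfl, by omega⟩
    · rcases lt_or_ge (i + 1) (n + k) with hlt | hge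
      · have hR := (hN i hai hlt (by omega)).rowReversal_middle (c := c) (by omega) (by omega)
        exact ⟨n - 1, hR, hR.flowsUp_middle (by omega) (by omega) (by omega) (by omega),
          by omega, by omega⟩
      · have hR := (hE i hge (by omega)).rowReversal_middle (c := c) hm (by omega) (by omega)
        exact ⟨n, hR, hR.flowsUp_middle (by omega) le_rfl (by omega) (by omega), le_rfl,
          by omega⟩
  | succ j ih =>
    intro i hi hai
    obtain ⟨K, hR, hU, hKn, hK⟩ := ih (i + 1) (by omega) (by omega)
    rcases lt_or_ge (i + 1) (n + k) with hlt | hge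
    · have hN := hN i hai hlt (by omega)
      have hR' := hN.rowReversal hc hai hm (by omega) (by omega) hKn hR
      exact ⟨K - 2, hR', hN.flowsUp hR' hR hm (by omega) (by omega) hKn (by omega) (by omega) hU,
        by omega, by omega⟩
    · have hE := hE i hge (by omega)
      have hR' := hE.rowReversal hc hai (by omega) (by omega) hR
      exact ⟨K, hR', hE.flowsUp hR' (by omega) hKn (by omega) (by omega) (by omega) hU, hKn,
        by omega⟩

/-- The orbit zigzags around the centre `z`: a position below `z` is reflected to `K - 1 - v ≥ z`,
and position `z + t + 1` leads to `z + t`, directly or through its reflection. -/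
theorem FirstEntry.exists_iterate (h : FirstEntry m n a c z f) (hn : a + 2 ≤ n) (hm : n ≤ m)
    (hc : c + a + 3 = m + n) (hR : RowReversal m n f c (a + 1) K) (hK : K ≤ a + 2)
    (hz : z = K / 2) : ∀ v ≤ a + 1,
      ∃ k : ℕ, f^[k] (m - 2 - a + v, n - 1 - v) = (m - 2 - a + z, n - 1 - z) := by
  have hR' : ∀ r v, r ≤ a + 1 → v ≤ a + 1 → (r + v + 1 = K ∨ (K ≤ r ∧ v = r)) →
      Flows f c (a + 1 - r, r) (m - 2 - a + v, n - 1 - v) := by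
    intro r v hr hv hrv
    exact hR _ _ _ _ (by omega) (by omega) (by omega) (by omega) (by omega) (by omega) (by omega)
  have hlt : ∀ v, v < z →
      ∃ k : ℕ, f^[k] (m - 2 - a + v, n - 1 - v) = (m - 2 - a + (K - 1 - v), n - 1 - (K - 1 - v)) :=
    fun v hv => exists_iterate_of_flows ((h.of_lt v hv).trans
      (hR' _ _ (by omega) (by omega) (by omega)))
  have hge : ∀ t, z + t ≤ a + 1 →
      ∃ k : ℕ, f^[k] (m - 2 - a + (z + t), n - 1 - (z + t)) = (m - 2 - a + z, n - 1 - z) := by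
    intro t
    induction t with
    | zero => exact fun _ => ⟨0, rfl⟩
    | succ t ih =>
      intro ht
      refine exists_iterate_trans ?_ (ih (by omega))
      have h1 := h.of_gt (z + (t + 1)) (by omega) ht
      rw [show a + 2 - (z + (t + 1)) = a + 1 - (z + t) by omega,
        show z + (t + 1) - 1 = z + t by omega] at h1
      by_cases hfix : K ≤ z + t ∨ z + t + (z + t) + 1 = K
      · exact exists_iterate_of_flows (h1.trans (hR' _ _ (by omega) (by omega) (by omega)))
      · refine exists_iterate_trans (exists_iterate_of_flows
          (h1.trans (hR' _ (K - 1 - (z + t)) (by omega) (by omega) (by omega)))) ?_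
        have h2 := hlt (K - 1 - (z + t)) (by omega)
        rwa [show K - 1 - (K - 1 - (z + t)) = z + t by omega] at h2
  intro v hv
  rcases lt_or_ge v z with h1 | h1
  · refine exists_iterate_trans (hlt v h1) ?_
    have h2 := hge (K - 1 - v - z) (by omega)
    rwa [show z + (K - 1 - v - z) = K - 1 - v by omega] at h2
  · have h2 := hge (v - z) (by omega)
    rwa [show z + (v - z) = v by omega] at h2

end

/-! ### Construction of the tour. -/

/-- The squares of the tour to `(x, y)` that travel east. -/
def GoesEast (m n a k x y : ℕ) (s : ℕ × ℕ) : Prop :=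
  (s.1 + s.2 = a ∧ (x + y = a → s.1 < x)) ∨
    (s.1 + s.2 + a + 3 = m + n ∧ x + y ≠ a ∧ s.1 < x) ∨
    (n + k ≤ s.1 + s.2 + 1 ∧ s.1 + s.2 + k + 2 ≤ m)

open Classical in
/-- A tour of the board with the terminal diagonal `a`: the other diagonals travel east if their
index is at least `n - 1 + k`, and north otherwise. -/
noncomputable def tour (m n a k x y : ℕ) (s : ℕ × ℕ) : ℕ × ℕ :=
  if s = (x, y) then (0, a + 1)
  else if GoesEast m n a k x y s then eastward m n s else northward m n s

section Tour

variable {m n a c x y z i k : ℕ}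

theorem tour_self : tour m n a k x y (x, y) = (0, a + 1) := if_pos rfl

theorem tour_east {p q : ℕ} (hne : p ≠ x ∨ q ≠ y) (h : GoesEast m n a k x y (p, q)) :
    tour m n a k x y (p, q) = eastward m n (p, q) := by
  rw [tour, if_neg (by simp only [Prod.mk.injEq]; omega), if_pos h]

theorem tour_north {p q : ℕ} (hne : p ≠ x ∨ q ≠ y) (h : ¬ GoesEast m n a k x y (p, q)) :
    tour m n a k x y (p, q) = northward m n (p, q) := by
  rw [tour, if_neg (by simp only [Prod.mk.injEq]; omega), if_neg h]

theorem tour_step {p q : ℕ} (hne : (p, q) ≠ (x, y)) :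
    tour m n a k x y (p, q) = eastward m n (p, q) ∨
      tour m n a k x y (p, q) = northward m n (p, q) := by
  have hne' : p ≠ x ∨ q ≠ y := by
    by_contra hcon
    push Not at hcon
    exact hne (Prod.ext hcon.1 hcon.2)
  by_cases h : GoesEast m n a k x y (p, q)
  · exact Or.inl (tour_east hne' h)
  · exact Or.inr (tour_north hne' h)

theorem eastward_inj {p q p' q' : ℕ} (hp : p < m) (hq : q < n) (hp' : p' < m) (hq' : q' < n)
    (h : eastward m n (p, q) = eastward m n (p', q')) : p = p' ∧ q = q' := by
  unfold eastward at h
  simp only at h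
  split_ifs at h <;> simp only [Prod.mk.injEq] at h <;> omega

theorem northward_inj {p q p' q' : ℕ} (hp : p < m) (hq : q < n) (hp' : p' < m) (hq' : q' < n)
    (h : northward m n (p, q) = northward m n (p', q')) : p = p' ∧ q = q' := by
  unfold northward at h
  simp only at h
  split_ifs at h <;> simp only [Prod.mk.injEq] at h <;> omega

theorem eq_of_eastward_eq_northward (hn : a + 2 ≤ n) (hm : n ≤ m) (hx : x < m) (hy : y < n)
    (hxy : x + y = a ∨ x + y + a + 3 = m + n) {p q p' q' : ℕ} (hp : p < m) (hq : q < n)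
    (hp' : p' < m) (hq' : q' < n) (hne : p ≠ x ∨ q ≠ y) (hne' : p' ≠ x ∨ q' ≠ y)
    (hE : GoesEast m n a k x y (p, q)) (hN : ¬ GoesEast m n a k x y (p', q'))
    (h : eastward m n (p, q) = northward m n (p', q')) : p = p' ∧ q = q' := by
  unfold GoesEast at hE hN
  unfold eastward northward at h
  simp only at hE hN h
  split_ifs at h <;> simp only [Prod.mk.injEq] at h <;> omega

theorem eastward_ne (hn : a + 2 ≤ n) (hm : n ≤ m) (hx : x < m)
    {p q : ℕ} (hp : p < m) (hq : q < n) (hE : GoesEast m n a k x y (p, q)) :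
    eastward m n (p, q) ≠ (0, a + 1) := by
  intro h
  unfold GoesEast at hE
  unfold eastward at h
  simp only at hE h
  split_ifs at h <;> simp only [Prod.mk.injEq] at h <;> omega

theorem northward_ne {p q : ℕ} (hne : p ≠ x ∨ q ≠ y) (hN : ¬ GoesEast m n a k x y (p, q)) :
    northward m n (p, q) ≠ (0, a + 1) := by
  intro h
  unfold GoesEast at hN
  unfold northward at h
  simp only at hN h
  split_ifs at h <;> simp only [Prod.mk.injEq] at h <;> omega

theorem tour_inj (hn : a + 2 ≤ n) (hm : n ≤ m) (hx : x < m) (hy : y < n)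
    (hxy : x + y = a ∨ x + y + a + 3 = m + n) {p q p' q' : ℕ} (hp : p < m) (hq : q < n)
    (hp' : p' < m) (hq' : q' < n) (h : tour m n a k x y (p, q) = tour m n a k x y (p', q')) :
    p = p' ∧ q = q' := by
  have hclose : ∀ {r s}, r < m → s < n → tour m n a k x y (r, s) = (0, a + 1) →
      r = x ∧ s = y := by
    intro r s hr hs hrs
    by_contra hne
    by_cases hE : GoesEast m n a k x y (r, s)
    · rw [tour_east (by omega) hE] at hrs
      exact eastward_ne hn hm hx hr hs hE hrs
    · rw [tour_north (by omega) hE] at hrs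
      exact northward_ne (by omega) hE hrs
  by_cases h1 : p = x ∧ q = y
  · obtain ⟨rfl, rfl⟩ := h1
    rw [tour_self] at h
    have := hclose hp' hq' h.symm
    omega
  by_cases h2 : p' = x ∧ q' = y
  · obtain ⟨rfl, rfl⟩ := h2
    rw [tour_self] at h
    exact hclose hp hq h
  by_cases hE : GoesEast m n a k x y (p, q) <;> by_cases hE' : GoesEast m n a k x y (p', q')
  · rw [tour_east (by omega) hE, tour_east (by omega) hE'] at h
    exact eastward_inj hp hq hp' hq' h
  · rw [tour_east (by omega) hE, tour_north (by omega) hE'] at h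
    exact eq_of_eastward_eq_northward hn hm hx hy hxy hp hq hp' hq' (by omega) (by omega)
      hE hE' h
  · rw [tour_north (by omega) hE, tour_east (by omega) hE'] at h
    have := eq_of_eastward_eq_northward hn hm hx hy hxy hp' hq' hp hq (by omega) (by omega)
      hE' hE h.symm
    omega
  · rw [tour_north (by omega) hE, tour_north (by omega) hE'] at h
    exact northward_inj hp hq hp' hq' h

theorem tour_travelsEast (hn : a + 2 ≤ n) (hxy : x + y = a ∨ x + y + a + 3 = m + n)
    (hi : n + k ≤ i + 1) (him : 2 * i + 3 ≤ m + n) : TravelsEast m n (tour m n a k x y) i := by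
  intro p q hp hq hpq
  exact tour_east (by omega) (by unfold GoesEast; simp only; omega)

theorem tour_travelsNorth (hxy : x + y = a ∨ x + y + a + 3 = m + n) (hia : i ≠ a)
    (hi : i + 1 < n + k) (him : 2 * i + 3 ≤ m + n) (ham : 2 * a + 3 ≤ m + n) :
    TravelsNorth m n (tour m n a k x y) i := by
  intro p q hp hq hpq
  exact tour_north (by omega) (by unfold GoesEast; simp only; omega)

theorem tour_outer (hn : a + 2 ≤ n) (hm : n ≤ m) (hc : c + a + 3 = m + n)
    (hxy : x + y = a ∨ x + y + a + 3 = m + n) : ∀ t ≤ a, ∀ u v, u + v = t →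
    Flows (tour m n a k x y) c (m - 1 - u, n - 1 - v) (u, v) := by
  refine flows_outer hn hm hc
    (fun i hi => Or.inr (tour_travelsNorth hxy (by omega) (by omega) (by omega) (by omega))) ?_
  rw [tour_north (by omega) (by unfold GoesEast; simp only; omega), northward_of_eq (by omega)]
  congr 1; omega

theorem tour_firstEntry (hn : a + 2 ≤ n) (hm : n ≤ m) (hx : x < m) (hy : y < n)
    (hc : c + a + 3 = m + n)
    (hxy : (x + y = a ∧ z = y + 1) ∨ (x + y + a + 3 = m + n ∧ z + y + 1 = n)) :
    FirstEntry m n a c z (tour m n a k x y) := by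
  have hout := tour_outer (k := k) hn hm hc (x := x) (y := y) (by omega)
  have hN : ∀ p q, (p ≠ x ∨ q ≠ y) → q + 1 < n → ¬ GoesEast m n a k x y (p, q) →
      tour m n a k x y (p, q) = (p, q + 1) := by
    intro p q hne hq h
    rw [tour_north hne h, northward_of_lt hq]
  have hE : ∀ p q, (p ≠ x ∨ q ≠ y) → p + 1 < m → GoesEast m n a k x y (p, q) →
      tour m n a k x y (p, q) = (p + 1, q) := by
    intro p q hne hp h
    rw [tour_east hne h, eastward_of_lt hp]
  rcases hxy with ⟨h, rfl⟩ | ⟨h, hz⟩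
  · refine firstEntry_of_lower hn hm hc hout h ?_ tour_self ?_ ?_ ?_
    · intro p q hpq hpx
      exact hE p q (by omega) (by omega) (by unfold GoesEast; simp only; omega)
    · intro p q hpq hpx
      exact hN p q (by omega) (by omega) (by unfold GoesEast; simp only; omega)
    · intro v hv hva
      rw [hN _ _ (by omega) (by omega) (by unfold GoesEast; simp only; omega)]
      congr 1; omega
    · rw [tour_north (by omega) (by unfold GoesEast; simp only; omega),
        northward_of_eq (by omega)]
      congr 1; omega
  · refine firstEntry_of_upper hn hm hc hout (by omega) ?_ ?_ ?_ ?_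
    · intro p q hpq
      exact hE p q (by omega) (by omega) (by unfold GoesEast; simp only; omega)
    · intro v hv
      rw [hE _ _ (by omega) (by omega) (by unfold GoesEast; simp only; omega)]
      congr 1; omega
    · rw [← tour_self (m := m) (n := n) (a := a) (k := k) (x := x) (y := y)]
      congr 2 <;> omega
    · intro v hv hva
      rw [hN _ _ (by omega) (by omega) (by unfold GoesEast; simp only; omega)]
      congr 1; omega

theorem tour_exists_iterate (hn : a + 2 ≤ n) (hm : n ≤ m) (hx : x < m) (hy : y < n)
    (hxy : (x + y = a ∧ z = y + 1) ∨ (x + y + a + 3 = m + n ∧ z + y + 1 = n))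
    (hk : z + (n - 2 - a) + k = n / 2) (hkm : k + (n + 1) / 2 ≤ (m + 1) / 2) {p q : ℕ}
    (hp : p < m) (hq : q < n) : ∃ l : ℕ, (tour m n a k x y)^[l] (p, q) = (x, y) := by
  obtain ⟨c, hc⟩ : ∃ c, c + a + 3 = m + n := ⟨m + n - 3 - a, by omega⟩
  have hxy' : x + y = a ∨ x + y + a + 3 = m + n := by omega
  have hout := tour_outer (k := k) hn hm hc hxy'
  have hentry := tour_firstEntry (k := k) hn hm hx hy hc hxy
  obtain ⟨K, hR, hU, hKn, hK⟩ := exists_rowReversal_flowsUp (f := tour m n a k x y) hn hm hc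
    (by omega) hkm (fun i h1 h2 => tour_travelsEast hn hxy' h1 h2)
    (fun i h1 h2 h3 => tour_travelsNorth hxy' (by omega) h2 h3 (by omega))
    ((m + n - 2) / 2 - (a + 1)) (a + 1) (by omega) (by omega)
  have hterm : ∃ l : ℕ, (tour m n a k x y)^[l] (m - 2 - a + z, n - 1 - z) = (x, y) := by
    rcases hxy with ⟨h, rfl⟩ | ⟨h, hz⟩
    · refine exists_iterate_of_flows (c := c) ?_
      rw [tour_north (by omega) (by unfold GoesEast; simp only; omega),
        northward_of_lt (by omega)]
      have := hout a le_rfl x y h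
      rwa [show m - 1 - x = m - 2 - a + (y + 1) by omega,
        show n - 1 - y = n - 1 - (y + 1) + 1 by omega] at this
    · exact ⟨0, Prod.ext (by simp only [Function.iterate_zero, id]; omega)
        (by simp only [Function.iterate_zero, id]; omega)⟩
  have hinner : ∀ p q, p < m → q < n → a + 1 ≤ p + q → p + q ≤ c →
      ∃ l : ℕ, (tour m n a k x y)^[l] (p, q) = (x, y) := by
    intro p q hp hq h1 h2
    obtain ⟨p', q', hp', hq', h3, h4⟩ := hU p q hp hq h1 (by omega)
    refine exists_iterate_trans h4.iterate (exists_iterate_trans ?_ hterm)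
    have := hentry.exists_iterate hn hm hc hR (by omega) (by omega) (n - 1 - q') (by omega)
    rwa [show m - 2 - a + (n - 1 - q') = p' by omega,
      show n - 1 - (n - 1 - q') = q' by omega] at this
  have hlower : ∀ t p q, p + q + t = a + 1 →
      ∃ l : ℕ, (tour m n a k x y)^[l] (p, q) = (x, y) := by
    intro t
    induction t with
    | zero => exact fun p q h => hinner p q (by omega) (by omega) (by omega) (by omega)
    | succ t ih =>
      intro p q h
      by_cases hτ : (p, q) = (x, y)
      · exact ⟨0, hτ⟩
      · refine exists_iterate_trans ⟨1, rfl⟩ ?_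
        rw [Function.iterate_one]
        -- In this corner neither move wraps, so both raise the level by one.
        rcases tour_step (k := k) (m := m) (n := n) (a := a) hτ with h1 | h1
        · rw [h1, eastward_of_lt (by omega)]
          exact ih _ _ (by omega)
        · rw [h1, northward_of_lt (by omega)]
          exact ih _ _ (by omega)
  rcases lt_or_ge c (p + q) with h1 | h1
  · have := hout _ (by omega) (m - 1 - p) (n - 1 - q) rfl
    rw [show m - 1 - (m - 1 - p) = p by omega, show n - 1 - (n - 1 - q) = q by omega] at this
    exact exists_iterate_trans this.iterate (hlower (a + 1 - (m - 1 - p + (n - 1 - q))) _ _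
      (by omega))
  · rcases lt_or_ge a (p + q) with h2 | h2
    · exact hinner p q hp hq h2 h1
    · exact hlower (a + 1 - (p + q)) p q (by omega)

end Tour

/-! ### The equivalence. -/

theorem mainTheorem3 (m n : ℕ) (hn : 3 ≤ n) (hmn : n ≤ m)
    (q : Fin n) (hq : 1 ≤ q.val) (x : Fin m) (y : Fin n) :
    (∃ H : List (Fin m × Fin n),
        IsHamiltonianPath (projectiveCheckerboard m n) (⟨0, by omega⟩, q) (x, y) H) ↔
      ((x.val + y.val = q.val - 1 ∧ (n - 1) / 2 ≤ q.val - 1 ∧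
          (n - 1) / 2 ≤ x.val ∧ x.val ≤ (m - 1) / 2) ∨
        (x.val + y.val = m + n - q.val - 2 ∧
          m / 2 ≤ x.val ∧ x.val ≤ m - (n + 1) / 2 ∧ (n - 1) / 2 ≤ q.val)) := by
  obtain ⟨q, hqn⟩ := q
  obtain ⟨x, hx⟩ := x
  obtain ⟨y, hy⟩ := y
  obtain ⟨a, rfl⟩ : ∃ a, q = a + 1 := ⟨q - 1, by simp only at hq; omega⟩
  simp only
  constructor
  · rintro ⟨H, hH⟩
    obtain ⟨f, T⟩ := hH.exists_closedTour
    obtain ⟨z, hz, h1, h2⟩ := T.terminal_bounds (by omega) hn hmn hx hy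
    simp only at hz
    omega
  · intro h
    obtain ⟨z, hz, h1, h2⟩ : ∃ z, ((x + y = a ∧ z = y + 1) ∨
        (x + y + a + 3 = m + n ∧ z + y + 1 = n)) ∧
        2 * z + n ≤ 2 * a + 4 ∧ 2 * a + 3 ≤ m + 2 * z := by
      rcases h with h | h
      · exact ⟨y + 1, by omega, by omega, by omega⟩
      · exact ⟨n - 1 - y, by omega, by omega, by omega⟩
    -- There are `n - 2 - a + k` north diagonals inside, so this `k` gives `K / 2 = z`. The first
    -- bound on `z` makes `k` exist; the second leaves room for it up to the middle.
    obtain ⟨k, hk⟩ : ∃ k, z + (n - 2 - a) + k = n / 2 :=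
      ⟨n / 2 - (z + (n - 2 - a)), by omega⟩
    exact exists_isHamiltonianPath_of_tour (tour m n a k x y)
      (fun p q _ _ hne => tour_step hne) tour_self
      (fun p q p' q' hp hq hp' hq' heq =>
        tour_inj (by omega) hmn hx hy (by omega) hp hq hp' hq' heq)
      (fun p q hp hq => tour_exists_iterate (by omega) hmn hx hy hz hk (by omega) hp hq)
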